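/- Let $(\mathcal{C}, e, \cdot)$ be a monoidal category. The category $\Sigma\Pi\mathcal{C}$ of polynomials in $\mathcal{C}$ has as objects formal expressions $\sum_{i\in I}\prod_{a\in A_i}c_{i,a}$, given by a set $I$, sets $A_i$ $(i\in I)$ and objects $c_{i,a}$ of $\mathcal{C}$. A morphism $\phi\colon\sum_{i\in I}\prod_{a\in A_i}c_{i,a}\to\sum_{j\in J}\prod_{b\in B_j}d_{j,b}$ consists of a function $\phi\colon I\to J$, functions $\phi^\sharp_i\colon B_{\phi i}\to A_i$ and morphisms $\phi_{i,b}\colon c_{i,\phi^\sharp_i b}\to d_{\phi i,b}$ of $\mathcal{C}$ for $i\in I$, $b\in B_{\phi i}$. It is a monoidal category $(\Sigma\Pi\mathcal{C},e,\triangleleft)$ under the composition product $$\Bigl(\sum_{i\in I}\prod_{a\in A_i}u_{i,a}\Bigr)\triangleleft\Bigl(\sum_{j\in J}\prod_{b\in B_j}v_{j,b}\Bigr)=\sum_{i\in I}\prod_{a\in A_i}\sum_{j\in J}\prod_{b\in B_j}(u_{i,a}\cdot v_{j,b})\cong\sum_{i\in I}\ \sum_{\bar\jmath\colon A_i\to J}\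 \prod_{a\in A_i}\ \prod_{b\in B_{\bar\jmath a}}(u_{i,a}\cdot v_{\bar\jmath a,b}),$$ whose unit is $e$, regarded as a polynomial with one position and one direction, and whose structure isomorphisms are induced by those of $\mathcal{C}$. The free coproduct completion $\Sigma\mathcal{C}^{\mathrm{op}}$ of $\mathcal{C}^{\mathrm{op}}$ has as objects the formal coproducts $\sum_{i\in I}c_i$ (a set $I$ and objects $c_i$ of $\mathcal{C}$); a morphism $\sum_{i\in I}c_i\to\sum_{j\in J}d_j$ consists of a function $\phi\colon I\to J$ and morphisms $d_{\phi i}\to c_i$ of $\mathcal{C}$ for $i\in I$. It is monoidal under Day convolution, $(\sum_{i\in I}c_i)\odot(\sum_{j\in J}d_j)=\sum_{(i,j)\in I\times J}c_i\cdot d_j$, with unit $e$. For a small category $\mathcal{A}$ enriched over $(\Sigma\mathcal{C}^{\mathrm{op}},e,\odot)$ write the hom-objects as $\sum_{f\colon x\to y}|f|$. The identities of $\mathcal{A}$ then consist of morphisms $\mathrm{id}_x\colon x\to x$ and maps $\eta_x\colon|\mathrm{id}_x|\to e$ of $\mathcal{C}$, and the composition of $\mathcal{A}$ consists of composites $gf\colon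 x\to z$ and maps $\mu_{f,g}\colon|gf|\to|f|\cdot|g|$ of $\mathcal{C}$ for $f\colon x\to y$, $g\colon y\to z$. An enriched cofunctor $\Phi\colon\mathcal{A}\nrightarrow\mathcal{B}$ between such categories consists of a function $\Phi\colon\mathrm{Ob}\,\mathcal{A}\to\mathrm{Ob}\,\mathcal{B}$ and, for each $a\in\mathcal{A}$ and each $f\colon\Phi a\to b$ in $\mathcal{B}$, a morphism $\Phi^\sharp_a f\colon a\to x$ of $\mathcal{A}$ with $\Phi x=b$ and a map $\Phi_{a,f}\colon|\Phi^\sharp_a f|\to|f|$ of $\mathcal{C}$. These must satisfy the following. - Identities: $\Phi^\sharp_a(\mathrm{id}_{\Phi a})=\mathrm{id}_a$ and $\eta_{\Phi a}\circ\Phi_{a,\mathrm{id}_{\Phi a}}=\eta_a$. - Composites: for $f\colon\Phi a\to b$ with $\Phi^\sharp_a f\colon a\to x$, and $g\colon b\to b'$, one has $\Phi^\sharp_a(gf)=\Phi^\sharp_x(g)\,\Phi^\sharp_a(f)$ and $\mu_{f,g}\circ\Phi_{a,gf}=(\Phi_{a,f}\cdot\Phi_{x,g})\circ\mu_{\Phi^\sharp_a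 f,\Phi^\sharp_x g}$. Enriched cofunctors compose by $(\Psi\Phi)^\sharp_a f=\Phi^\sharp_a(\Psi^\sharp_{\Phi a}f)$ and $(\Psi\Phi)_{a,f}=\Psi_{\Phi a,f}\circ\Phi_{a,\Psi^\sharp_{\Phi a}f}$. **Theorem.** The category of comonoids in the monoidal category $(\Sigma\Pi\mathcal{C},e,\triangleleft)$ is equivalent to the category of small $(\Sigma\mathcal{C}^{\mathrm{op}},e,\odot)$-enriched categories and enriched cofunctors. -/

import Mathlib

open CategoryTheory MonoidalCategory Limits

universe w v u

/-- The pentagon identity, written with `⊗ₘ` only. -/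
theorem pentagon_tensorHom {C : Type u} [Category.{v} C] [MonoidalCategory C] (W X Y Z : C) :
    ((α_ W X Y).hom ⊗ₘ 𝟙 Z) ≫ (α_ W (X ⊗ Y) Z).hom ≫ (𝟙 W ⊗ₘ (α_ X Y Z).hom) =
      (α_ (W ⊗ X) Y Z).hom ≫ (α_ W X (Y ⊗ Z)).hom := by
  simp only [id_tensorHom, tensorHom_id, pentagon]

/-- The triangle identity, written with `⊗ₘ` only. -/
theorem triangle_tensorHom {C : Type u} [Category.{v} C] [MonoidalCategory C] (X Y : C) :
    (α_ X (𝟙_ C) Y).hom ≫ (𝟙 X ⊗ₘ (λ_ Y).hom) = (ρ_ X).hom ⊗ₘ 𝟙 Y := by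
  simp only [id_tensorHom, tensorHom_id, triangle]

/-- An object `∑ (i : I), ∏ (a : A i), c i a` of the category of polynomials in `C`. -/
structure PolyIn (C : Type u) : Type (max u (w + 1)) where
  /-- positions -/
  pos : Type w
  /-- directions at a position -/
  dir : pos → Type w
  /-- predicates -/
  pred : (i : pos) → dir i → C

namespace PolyIn

variable {C : Type u} [Category.{v} C]

/-- A morphism of polynomials: forward on positions, backward on directions, and forward on
predicates. -/
structure Hom (P Q : PolyIn.{w} C) : Type (max v w) where
  /-- on-positions function -/
  onPos : P.pos → Q.pos
  /-- on-directions functions -/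
  onDir : (i : P.pos) → Q.dir (onPos i) → P.dir i
  /-- on-predicates maps -/
  onPred : (i : P.pos) → (b : Q.dir (onPos i)) → (P.pred i (onDir i b) ⟶ Q.pred (onPos i) b)

instance category : Category (PolyIn.{w} C) where
  Hom P Q := Hom P Q
  id P := ⟨fun i => i, fun _ a => a, fun i a => 𝟙 (P.pred i a)⟩
  comp f g :=
    ⟨fun i => g.onPos (f.onPos i),
     fun i c => f.onDir i (g.onDir (f.onPos i) c),
     fun i c => f.onPred i (g.onDir (f.onPos i) c) ≫ g.onPred (f.onPos i) c⟩
  id_comp f := by simp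
  comp_id f := by simp
  assoc f g h := by simp

/-- Two morphisms with the same position and direction functions agree as soon as their predicate
maps agree. -/
theorem hom_mk_congr {P Q : PolyIn.{w} C} {p : P.pos → Q.pos}
    {d : (i : P.pos) → Q.dir (p i) → P.dir i}
    {m m' : (i : P.pos) → (b : Q.dir (p i)) → (P.pred i (d i b) ⟶ Q.pred (p i) b)}
    (h : ∀ i b, m i b = m' i b) :
    (Hom.mk p d m : P ⟶ Q) = Hom.mk p d m' := by
  have : m = m' := funext fun i => funext fun b => h i b
  rw [this]

variable [MonoidalCategory C]

/-- The monoidal unit `e`, seen as the polynomial with one position and one direction. -/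
def compUnit : PolyIn.{w} C := ⟨PUnit, fun _ => PUnit, fun _ _ => 𝟙_ C⟩

/-- The composition product
`(∑ i, ∏ a, u i a) ◁ (∑ j, ∏ b, v j b) = ∑ i, ∏ a, ∑ j, ∏ b, (u i a ⊗ v j b)`,
written out by distributivity of products over coproducts as
`∑ (i, j̄ : A i → J), ∏ (a : A i, b : B (j̄ a)), (u i a ⊗ v (j̄ a) b)`. -/
def compProd (P Q : PolyIn.{w} C) : PolyIn.{w} C where
  pos := Σ i : P.pos, P.dir i → Q.pos
  dir x := Σ a : P.dir x.1, Q.dir (x.2 a)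
  pred x y := P.pred x.1 y.1 ⊗ Q.pred (x.2 y.1) y.2

/-- The composition product of two morphisms. -/
def compProdMap {P P' Q Q' : PolyIn.{w} C} (f : P ⟶ P') (g : Q ⟶ Q') :
    compProd P Q ⟶ compProd P' Q' :=
  Hom.mk
    (fun x => ⟨f.onPos x.1, fun c => g.onPos (x.2 (f.onDir x.1 c))⟩)
    (fun x y => ⟨f.onDir x.1 y.1, g.onDir (x.2 (f.onDir x.1 y.1)) y.2⟩)
    (fun x y => f.onPred x.1 y.1 ⊗ₘ g.onPred (x.2 (f.onDir x.1 y.1)) y.2)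

/-- The associator, induced by that of `C`. -/
def compAssociator (P Q R : PolyIn.{w} C) :
    compProd (compProd P Q) R ≅ compProd P (compProd Q R) where
  hom := Hom.mk
    (fun x => ⟨x.1.1, fun a => ⟨x.1.2 a, fun b => x.2 ⟨a, b⟩⟩⟩)
    (fun _ y => ⟨⟨y.1, y.2.1⟩, y.2.2⟩)
    (fun _ _ => (α_ _ _ _).hom)
  inv := Hom.mk
    (fun x => ⟨⟨x.1, fun a => (x.2 a).1⟩, fun y => (x.2 y.1).2 y.2⟩)
    (fun _ y => ⟨y.1.1, ⟨y.1.2, y.2⟩⟩)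
    (fun _ _ => (α_ _ _ _).inv)
  hom_inv_id := hom_mk_congr fun _ _ => Iso.hom_inv_id _
  inv_hom_id := hom_mk_congr fun _ _ => Iso.inv_hom_id _

/-- The left unitor, induced by that of `C`. -/
def compLeftUnitor (P : PolyIn.{w} C) : compProd compUnit P ≅ P where
  hom := Hom.mk (fun x => x.2 PUnit.unit) (fun _ b => ⟨PUnit.unit, b⟩) (fun _ _ => (λ_ _).hom)
  inv := Hom.mk (fun i => ⟨PUnit.unit, fun _ => i⟩) (fun _ y => y.2) (fun _ _ => (λ_ _).inv)
  hom_inv_id := hom_mk_congr fun _ _ => Iso.hom_inv_id _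
  inv_hom_id := hom_mk_congr fun _ _ => Iso.inv_hom_id _

/-- The right unitor, induced by that of `C`. -/
def compRightUnitor (P : PolyIn.{w} C) : compProd P compUnit ≅ P where
  hom := Hom.mk (fun x => x.1) (fun _ a => ⟨a, PUnit.unit⟩) (fun _ _ => (ρ_ _).hom)
  inv := Hom.mk (fun i => ⟨i, fun _ => PUnit.unit⟩) (fun _ y => y.1) (fun _ _ => (ρ_ _).inv)
  hom_inv_id := hom_mk_congr fun _ _ => Iso.hom_inv_id _
  inv_hom_id := hom_mk_congr fun _ _ => Iso.inv_hom_id _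

instance monoidalCategoryStruct : MonoidalCategoryStruct (PolyIn.{w} C) where
  tensorObj := compProd
  whiskerLeft P _ _ g := compProdMap (𝟙 P) g
  whiskerRight f Q := compProdMap f (𝟙 Q)
  tensorHom := compProdMap
  tensorUnit := compUnit
  associator := compAssociator
  leftUnitor := compLeftUnitor
  rightUnitor := compRightUnitor

/-- The monoidal category `(ΣΠC, e, ◁)` of polynomials in `C` under the composition product. -/
instance monoidalCategory : MonoidalCategory (PolyIn.{w} C) :=
  MonoidalCategory.ofTensorHom
    (id_tensorHom_id := fun _ _ => hom_mk_congr fun _ _ => id_tensorHom_id _ _)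
    (id_tensorHom := fun _ _ _ _ => rfl)
    (tensorHom_id := fun _ _ => rfl)
    (tensorHom_comp_tensorHom := fun _ _ _ _ =>
      hom_mk_congr fun _ _ => tensorHom_comp_tensorHom _ _ _ _)
    (associator_naturality := fun _ _ _ => hom_mk_congr fun _ _ => associator_naturality _ _ _)
    (leftUnitor_naturality := fun f => hom_mk_congr fun x b =>
      (congrArg (· ≫ _) (id_tensorHom _ _)).trans
        (leftUnitor_naturality (f.onPred (x.2 PUnit.unit) b)))
    (rightUnitor_naturality := fun f => hom_mk_congr fun x b =>
      (congrArg (· ≫ _) (tensorHom_id _ _)).trans (rightUnitor_naturality (f.onPred x.1 b)))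
    (pentagon := fun _ _ _ _ => hom_mk_congr fun _ _ => pentagon_tensorHom _ _ _ _)
    (triangle := fun _ _ => hom_mk_congr fun _ _ => triangle_tensorHom _ _)

end PolyIn

namespace DayFormalCoproduct

variable {D : Type u} [Category.{v} D]

/-- Two morphisms of formal coproducts with the same index function agree as soon as their
components agree. -/
theorem hom_mk_congr {X Y : FormalCoproduct.{w} D} {p : X.I → Y.I}
    {m m' : (i : X.I) → (X.obj i ⟶ Y.obj (p i))} (h : ∀ i, m i = m' i) :
    (FormalCoproduct.Hom.mk p m : X ⟶ Y) = FormalCoproduct.Hom.mk p m' := by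
  have : m = m' := funext h
  rw [this]

variable [MonoidalCategory D]

/-- Day convolution of formal coproducts:
`(∑ i, c i) ⊙ (∑ j, d j) = ∑ (i, j), c i ⊗ d j`. -/
def tensor (X Y : FormalCoproduct.{w} D) : FormalCoproduct.{w} D :=
  ⟨X.I × Y.I, fun p => X.obj p.1 ⊗ Y.obj p.2⟩

/-- Day convolution of morphisms of formal coproducts. -/
def tensorMap {X X' Y Y' : FormalCoproduct.{w} D} (f : X ⟶ X') (g : Y ⟶ Y') :
    tensor X Y ⟶ tensor X' Y' :=
  FormalCoproduct.Hom.mk (fun p => (f.f p.1, g.f p.2)) (fun p => f.φ p.1 ⊗ₘ g.φ p.2)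

instance monoidalCategoryStruct : MonoidalCategoryStruct (FormalCoproduct.{w} D) where
  tensorObj := tensor
  whiskerLeft X _ _ g := tensorMap (𝟙 X) g
  whiskerRight f Y := tensorMap f (𝟙 Y)
  tensorHom := tensorMap
  tensorUnit := ⟨PUnit, fun _ => 𝟙_ D⟩
  associator _ _ _ :=
    { hom := FormalCoproduct.Hom.mk (fun p => (p.1.1, (p.1.2, p.2))) (fun _ => (α_ _ _ _).hom)
      inv := FormalCoproduct.Hom.mk (fun p => ((p.1, p.2.1), p.2.2)) (fun _ => (α_ _ _ _).inv)
      hom_inv_id := hom_mk_congr fun _ => Iso.hom_inv_id _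
      inv_hom_id := hom_mk_congr fun _ => Iso.inv_hom_id _ }
  leftUnitor _ :=
    { hom := FormalCoproduct.Hom.mk (fun p => p.2) (fun _ => (λ_ _).hom)
      inv := FormalCoproduct.Hom.mk (fun i => (PUnit.unit, i)) (fun _ => (λ_ _).inv)
      hom_inv_id := hom_mk_congr fun _ => Iso.hom_inv_id _
      inv_hom_id := hom_mk_congr fun _ => Iso.inv_hom_id _ }
  rightUnitor _ :=
    { hom := FormalCoproduct.Hom.mk (fun p => p.1) (fun _ => (ρ_ _).hom)
      inv := FormalCoproduct.Hom.mk (fun i => (i, PUnit.unit)) (fun _ => (ρ_ _).inv)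
      hom_inv_id := hom_mk_congr fun _ => Iso.hom_inv_id _
      inv_hom_id := hom_mk_congr fun _ => Iso.inv_hom_id _ }

/-- The monoidal category `(ΣD, e, ⊙)`: the free coproduct completion with Day convolution. -/
instance monoidalCategory : MonoidalCategory (FormalCoproduct.{w} D) :=
  MonoidalCategory.ofTensorHom
    (id_tensorHom_id := fun _ _ => hom_mk_congr fun _ => id_tensorHom_id _ _)
    (id_tensorHom := fun _ _ _ _ => rfl)
    (tensorHom_id := fun _ _ => rfl)
    (tensorHom_comp_tensorHom := fun _ _ _ _ =>
      hom_mk_congr fun _ => tensorHom_comp_tensorHom _ _ _ _)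
    (associator_naturality := fun _ _ _ => hom_mk_congr fun _ => associator_naturality _ _ _)
    (leftUnitor_naturality := fun f => hom_mk_congr fun p =>
      (congrArg (· ≫ _) (id_tensorHom _ _)).trans (leftUnitor_naturality (f.φ p.2)))
    (rightUnitor_naturality := fun f => hom_mk_congr fun p =>
      (congrArg (· ≫ _) (tensorHom_id _ _)).trans (rightUnitor_naturality (f.φ p.1)))
    (pentagon := fun _ _ _ _ => hom_mk_congr fun _ => pentagon_tensorHom _ _ _ _)
    (triangle := fun _ _ => hom_mk_congr fun _ => triangle_tensorHom _ _)

end DayFormalCoproduct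

/-- A small category enriched over `(ΣCᵒᵖ, e, ⊙)`. -/
structure SmallEnrichedCat (C : Type u) [Category.{v} C] [MonoidalCategory C] :
    Type (max u v (w + 1)) where
  /-- the set of objects -/
  Ob : Type w
  /-- the enriched category structure -/
  [enriched : EnrichedCategory (FormalCoproduct.{w} Cᵒᵖ) Ob]

namespace SmallEnrichedCat

attribute [instance] SmallEnrichedCat.enriched

variable {C : Type u} [Category.{v} C] [MonoidalCategory C]

section components

variable (A : SmallEnrichedCat.{w} C)

/-- The hom-set `A(x, y)`: the index set of the hom-object `∑ (f : x → y), |f|`. -/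
def Mor (x y : A.Ob) : Type w := (EnrichedCategory.Hom (V := FormalCoproduct.{w} Cᵒᵖ) x y).I

variable {A}

/-- The weight `|f|` of a morphism. -/
def weight {x y : A.Ob} (f : A.Mor x y) : C :=
  ((EnrichedCategory.Hom (V := FormalCoproduct.{w} Cᵒᵖ) x y).obj f).unop

/-- The identity morphism `id_x : x → x`. -/
def idMor (x : A.Ob) : A.Mor x x :=
  (eId (FormalCoproduct.{w} Cᵒᵖ) x).f PUnit.unit

/-- The identity map `η_x : |id_x| ⟶ e`. -/
def idMap (x : A.Ob) : weight (idMor x) ⟶ 𝟙_ C :=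
  ((eId (FormalCoproduct.{w} Cᵒᵖ) x).φ PUnit.unit).unop

/-- The composite `gf : x → z` of `f : x → y` and `g : y → z`. -/
def compMor {x y z : A.Ob} (f : A.Mor x y) (g : A.Mor y z) : A.Mor x z :=
  (eComp (FormalCoproduct.{w} Cᵒᵖ) x y z).f (f, g)

/-- The composite map `μ_{f,g} : |gf| ⟶ |f| ⊗ |g|`. -/
def compMap {x y z : A.Ob} (f : A.Mor x y) (g : A.Mor y z) :
    weight (compMor f g) ⟶ weight f ⊗ weight g :=
  ((eComp (FormalCoproduct.{w} Cᵒᵖ) x y z).φ (f, g)).unop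

end components

/-- A morphism `mor : a → cod` out of the object `a`, with a map `|mor| ⟶ c` from its weight. -/
structure WeightedMor {A : SmallEnrichedCat.{w} C} (a : A.Ob) (c : C) : Type (max v w) where
  /-- the codomain -/
  cod : A.Ob
  /-- the morphism -/
  mor : A.Mor a cod
  /-- the map from its weight -/
  map : weight mor ⟶ c

namespace WeightedMor

variable {A : SmallEnrichedCat.{w} C}

/-- Postcompose the map from the weight with `u : c ⟶ c'`. -/
def post {a : A.Ob} {c c' : C} (t : WeightedMor a c) (u : c ⟶ c') : WeightedMor a c' :=
  ⟨t.cod, t.mor, t.map ≫ u⟩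

/-- A morphism with the identity map of its weight. -/
def ofMor {x y : A.Ob} (f : A.Mor x y) : WeightedMor x (weight f) := ⟨y, f, 𝟙 _⟩

/-- `id_a : a → a` with `η_a : |id_a| ⟶ e`. -/
def unit (a : A.Ob) : WeightedMor a (𝟙_ C) := ⟨a, idMor a, idMap a⟩

/-- Given `f : a → x` with `p : |f| ⟶ c` and `g : x → y` with `q : |g| ⟶ c'`, the composite
`gf : a → y` with `|gf| ⟶ |f| ⊗ |g| ⟶ c ⊗ c'`. -/
def comp {a : A.Ob} {c c' : C} (t : WeightedMor a c) (s : WeightedMor t.cod c') :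
    WeightedMor a (c ⊗ c') :=
  ⟨s.cod, compMor t.mor s.mor, compMap t.mor s.mor ≫ (t.map ⊗ₘ s.map)⟩

end WeightedMor

/-- An enriched cofunctor `Φ : A ⇸ B`. The lift is written for a morphism `f : b → b'` of `B` and an
object `a` of `A` with `Φ a = b` (so that `f : Φ a → b'`); it consists of the codomain `x` and the
morphism `Φ♯_a f : a → x` of `A`, with `Φ x = b'`, and of the map `Φ_{a,f} : |Φ♯_a f| ⟶ |f|`. -/
structure EnrichedCofunctor (A B : SmallEnrichedCat.{w} C) : Type (max v w) where
  /-- the function on objects -/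
  obj : A.Ob → B.Ob
  /-- the lifts `Φ♯_a f`, with the maps `Φ_{a,f}` -/
  lift {a : A.Ob} {b b' : B.Ob} (h : obj a = b) (f : B.Mor b b') : WeightedMor a (weight f)
  /-- the codomain of `Φ♯_a f` is sent to the codomain of `f` -/
  obj_cod {a : A.Ob} {b b' : B.Ob} (h : obj a = b) (f : B.Mor b b') : obj (lift h f).cod = b'
  /-- preservation of identities: `Φ♯_a id = id_a`, and `Φ_{a,id} ≫ η_{Φ a} = η_a` -/
  lift_id {a : A.Ob} {b : B.Ob} (h : obj a = b) :
    (lift h (idMor b)).post (idMap b) = WeightedMor.unit a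
  /-- preservation of composites: `Φ♯_a (gf) = Φ♯_x g ∘ Φ♯_a f` for `Φ♯_a f : a → x`, and
  `Φ_{a,gf} ≫ μ_{f,g} = μ_{Φ♯_a f, Φ♯_x g} ≫ (Φ_{a,f} ⊗ Φ_{x,g})` -/
  lift_comp {a : A.Ob} {b b' b'' : B.Ob} (h : obj a = b) (f : B.Mor b b') (g : B.Mor b' b'') :
    (lift h (compMor f g)).post (compMap f g) = (lift h f).comp (lift (obj_cod h f) g)

namespace EnrichedCofunctor

variable {A B D : SmallEnrichedCat.{w} C}

theorem ext' {F G : EnrichedCofunctor A B} (h₁ : ∀ a, F.obj a = G.obj a)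
    (h₂ : ∀ {a : A.Ob} {b b' : B.Ob} (hF : F.obj a = b) (hG : G.obj a = b) (f : B.Mor b b'),
      F.lift hF f = G.lift hG f) : F = G := by
  obtain ⟨o, l, _, _, _⟩ := F
  obtain ⟨o', l', _, _, _⟩ := G
  obtain rfl : o = o' := funext h₁
  have hl : @l = @l' := by
    funext a b b' h f
    exact h₂ h h f
  subst hl
  rfl

/-- Lift a weighted morphism along a cofunctor: `|Φ♯_a k| ⟶ |k| ⟶ c`. -/
def push (F : EnrichedCofunctor A B) {a : A.Ob} {b : B.Ob} {c : C} (h : F.obj a = b)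
    (t : WeightedMor b c) : WeightedMor a c :=
  (F.lift h t.mor).post t.map

theorem push_post (F : EnrichedCofunctor A B) {a : A.Ob} {b : B.Ob} {c c' : C} (h : F.obj a = b)
    (t : WeightedMor b c) (u : c ⟶ c') : F.push h (t.post u) = (F.push h t).post u := by
  simp [push, WeightedMor.post]

theorem push_unit (F : EnrichedCofunctor A B) {a : A.Ob} {b : B.Ob} (h : F.obj a = b) :
    F.push h (WeightedMor.unit b) = WeightedMor.unit a :=
  F.lift_id h

theorem push_comp (F : EnrichedCofunctor A B) {a : A.Ob} {b : B.Ob} {c c' : C} (h : F.obj a = b)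
    (t : WeightedMor b c) (s : WeightedMor t.cod c') :
    F.push h (t.comp s) = (F.push h t).comp (F.push (F.obj_cod h t.mor) s) := by
  have := congrArg (fun r => r.post (t.map ⊗ₘ s.map)) (F.lift_comp h t.mor s.mor)
  simpa [push, WeightedMor.post, WeightedMor.comp] using this

theorem push_lift (F : EnrichedCofunctor A B) (G : EnrichedCofunctor B D) {a : A.Ob} {b : B.Ob}
    {d d' : D.Ob} (h : F.obj a = b) (hG : G.obj b = d) (hG' : G.obj (F.obj a) = d)
    (f : D.Mor d d') : F.push h (G.lift hG f) = F.push rfl (G.lift hG' f) := by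
  subst h
  rfl

/-- The identity cofunctor. -/
def id (A : SmallEnrichedCat.{w} C) : EnrichedCofunctor A A where
  obj a := a
  lift h f := h.symm ▸ WeightedMor.ofMor f
  obj_cod := by rintro a _ b' rfl f; rfl
  lift_id := by
    rintro a _ rfl
    simp [WeightedMor.post, WeightedMor.ofMor, WeightedMor.unit]
  lift_comp := by
    rintro a _ b' b'' rfl f g
    simp [WeightedMor.post, WeightedMor.ofMor, WeightedMor.comp]

/-- The composite cofunctor, with lifts `(Ψ ∘ Φ)♯_a f = Φ♯_a (Ψ♯_{Φ a} f)`. -/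
def comp (F : EnrichedCofunctor A B) (G : EnrichedCofunctor B D) : EnrichedCofunctor A D where
  obj a := G.obj (F.obj a)
  lift h f := F.push rfl (G.lift h f)
  obj_cod h f := (congrArg G.obj (F.obj_cod rfl _)).trans (G.obj_cod h f)
  lift_id h := by rw [← push_post, G.lift_id, push_unit]
  lift_comp h f g := by
    rw [← push_post, G.lift_comp, push_comp]
    exact congrArg _ (push_lift F G _ _ _ g)

end EnrichedCofunctor

/-- The category of small `(ΣCᵒᵖ, e, ⊙)`-enriched categories and enriched cofunctors. -/
instance category : Category (SmallEnrichedCat.{w} C) where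
  Hom := EnrichedCofunctor
  id := EnrichedCofunctor.id
  comp := EnrichedCofunctor.comp
  id_comp F := EnrichedCofunctor.ext' (fun _ => rfl) (by
    rintro a _ b' rfl hG f
    simp [EnrichedCofunctor.comp, EnrichedCofunctor.id, EnrichedCofunctor.push,
      WeightedMor.post, WeightedMor.ofMor])
  comp_id F := EnrichedCofunctor.ext' (fun _ => rfl) (by
    rintro a _ b' rfl hG f
    simp [EnrichedCofunctor.comp, EnrichedCofunctor.id, EnrichedCofunctor.push,
      WeightedMor.post, WeightedMor.ofMor])
  assoc F G H := EnrichedCofunctor.ext' (fun _ => rfl) (by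
    rintro a _ b' rfl hG f
    simp [EnrichedCofunctor.comp, EnrichedCofunctor.push, WeightedMor.post])

end SmallEnrichedCat

/-! A comonoid for `◁` is a category in disguise. The counit picks a direction at each position, the
identity. By the right counit law the comultiplication sends a position `i` to a pair `(i, cod i)`,
where `cod i` assigns to each direction at `i` a codomain; on directions it composes. The remaining
counit and coassociativity laws, read on positions, give the codomains of identities and composites;
read on directions and predicates, they are the unit and associativity laws with weights.
Conversely, an enriched category yields its outfacing polynomial, and `toComon` is the resulting
functor. It is full and faithful because compatibility with comultiplication says, on positions,
that lifts have the right codomain and, on directions, that composites are preserved, while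
compatibility with the counit is preservation of identities (`comp_comul_eq_iff`,
`comp_counit_eq_iff`). Essential surjectivity rests on `exists_catStr` and `outPolyIso`. The type of
a direction depends on a position, and the positions to be compared are often only propositionally
equal. Families indexed by all positions equal to a given one absorb these transports. -/

namespace PolyIn

/-! ### Equality of polynomial morphisms -/

section Category

variable {C : Type u} [Category.{v} C]

/-- A direction of `P` at `i`, with a map from its predicate to `c`. -/
structure WeightedDir (P : PolyIn.{w} C) (i : P.pos) (c : C) : Type (max v w) where
  /-- the direction -/
  dir : P.dir i
  /-- the map from its predicate -/
  map : P.pred i dir ⟶ c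

namespace WeightedDir

variable {P : PolyIn.{w} C} {i : P.pos} {c c' : C}

/-- Postcompose the map from the predicate with `u : c ⟶ c'`. -/
def post (t : WeightedDir P i c) (u : c ⟶ c') : WeightedDir P i c' := ⟨t.dir, t.map ≫ u⟩

end WeightedDir

variable {P Q : PolyIn.{w} C}

/-- The direction map and the predicate map of a morphism of polynomials at a direction. -/
def Hom.at (f : P ⟶ Q) (i : P.pos) (b : Q.dir (f.onPos i)) :
    WeightedDir P i (Q.pred (f.onPos i) b) :=
  ⟨f.onDir i b, f.onPred i b⟩

/-- Two morphisms `f` and `g` of polynomials agree if they agree on positions and a family indexed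
by the positions equal to `f.onPos i` restricts to the components of `f` and to those of `g`. -/
theorem hom_ext_of_family {f g : P ⟶ Q} (h : ∀ i, f.onPos i = g.onPos i)
    (t : ∀ i j, f.onPos i = j → ∀ b : Q.dir j, WeightedDir P i (Q.pred j b))
    (hf : ∀ i b, t i _ rfl b = Hom.at f i b) (hg : ∀ i b, t i _ (h i) b = Hom.at g i b) :
    f = g := by
  obtain ⟨p, d, m⟩ := f
  obtain ⟨p', d', m'⟩ := g
  obtain rfl : p = p' := funext h
  have H : ∀ i b, (⟨d i b, m i b⟩ : WeightedDir P i (Q.pred (p i) b)) = ⟨d' i b, m' i b⟩ :=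
    fun i b => (hf i b).symm.trans (hg i b)
  obtain rfl : d = d' := funext fun i => funext fun b => congrArg WeightedDir.dir (H i b)
  exact hom_mk_congr fun i b => by simpa using H i b

/-- A family that restricts to the components of `f` restricts to those of every `g` equal to
`f`. -/
theorem family_eq_of_hom_eq {f g : P ⟶ Q} (e : f = g)
    (t : ∀ i j, f.onPos i = j → ∀ b : Q.dir j, WeightedDir P i (Q.pred j b))
    (hf : ∀ i b, t i _ rfl b = Hom.at f i b) (i : P.pos) (h : f.onPos i = g.onPos i)
    (b : Q.dir (g.onPos i)) : t i _ h b = Hom.at g i b := by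
  subst e
  exact hf i b

/-- A family which restricts to the components of `g` restricts to those of every `f` equal to
`g`. -/
theorem family_rfl_eq_iff {f g : P ⟶ Q} (h : ∀ i, f.onPos i = g.onPos i)
    (t : ∀ i j, f.onPos i = j → ∀ b : Q.dir j, WeightedDir P i (Q.pred j b))
    (hg : ∀ i b, t i _ (h i) b = Hom.at g i b) :
    f = g ↔ ∀ i b, t i _ rfl b = Hom.at f i b := by
  constructor
  · rintro rfl
    exact hg
  · intro hf
    exact hom_ext_of_family h t hf hg

/-- The shared position function removes all transport between direction types; bundling each
direction with its map then makes equality pointwise. -/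
theorem hom_mk_eq_iff {p : P.pos → Q.pos}
    {d d' : (i : P.pos) → Q.dir (p i) → P.dir i}
    {m : (i : P.pos) → (b : Q.dir (p i)) → (P.pred i (d i b) ⟶ Q.pred (p i) b)}
    {m' : (i : P.pos) → (b : Q.dir (p i)) → (P.pred i (d' i b) ⟶ Q.pred (p i) b)} :
    (Hom.mk p d m : P ⟶ Q) = Hom.mk p d' m' ↔
      ∀ i b, (⟨d i b, m i b⟩ : WeightedDir P i (Q.pred (p i) b)) = ⟨d' i b, m' i b⟩ := by
  constructor
  · intro e i b
    cases e
    rfl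
  · intro h
    obtain rfl : d = d' := funext fun i => funext fun b => congrArg WeightedDir.dir (h i b)
    exact hom_mk_congr fun i b => by simpa using h i b

end Category

end PolyIn

namespace SmallEnrichedCat

variable {C : Type u} [Category.{v} C] [MonoidalCategory C]

/-! ### The comonoid of an enriched category -/

section laws

variable {A : SmallEnrichedCat.{w} C}

/-- Used to read the enriched category axioms componentwise, with the maps taken in `C` rather than
`Cᵒᵖ`. -/
theorem WeightedMor.mk_eq_of_hom_eq {x y : A.Ob} {X : FormalCoproduct.{w} Cᵒᵖ}
    {k k' : X ⟶ EnrichedCategory.Hom x y} (e : k = k') (i : X.I) :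
    (⟨y, k.f i, (k.φ i).unop⟩ : WeightedMor x (X.obj i).unop) = ⟨y, k'.f i, (k'.φ i).unop⟩ := by
  rw [e]

theorem idMor_comp {x y : A.Ob} (f : A.Mor x y) :
    (⟨y, compMor (idMor x) f, compMap (idMor x) f ≫ (idMap x ⊗ₘ 𝟙 (weight f))⟩ :
      WeightedMor x (𝟙_ C ⊗ weight f)) = ⟨y, f, (λ_ (weight f)).inv⟩ := by
  -- The enriched unit law ends in `(λ_ _).hom`; cancelling it leaves the inverse unitor of the
  -- comonoid counit law.
  have h : (⟨y, compMor (idMor x) f,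
      (compMap (idMor x) f ≫ (idMap x ⊗ₘ 𝟙 (weight f))) ≫ (λ_ (weight f)).hom⟩ :
      WeightedMor x (weight f)) = ⟨y, f, 𝟙 (weight f)⟩ :=
    WeightedMor.mk_eq_of_hom_eq (e_id_comp (FormalCoproduct.{w} Cᵒᵖ) x y) f
  simpa [WeightedMor.post] using congrArg (fun t => t.post (λ_ (weight f)).inv) h

theorem comp_idMor {x y : A.Ob} (f : A.Mor x y) :
    (⟨y, compMor f (idMor y), compMap f (idMor y) ≫ (𝟙 (weight f) ⊗ₘ idMap y)⟩ :
      WeightedMor x (weight f ⊗ 𝟙_ C)) = ⟨y, f, (ρ_ (weight f)).inv⟩ := by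
  have h : (⟨y, compMor f (idMor y),
      (compMap f (idMor y) ≫ (𝟙 (weight f) ⊗ₘ idMap y)) ≫ (ρ_ (weight f)).hom⟩ :
      WeightedMor x (weight f)) = ⟨y, f, 𝟙 (weight f)⟩ :=
    WeightedMor.mk_eq_of_hom_eq (e_comp_id (FormalCoproduct.{w} Cᵒᵖ) x y) f
  simpa [WeightedMor.post] using congrArg (fun t => t.post (ρ_ (weight f)).inv) h

theorem comp_assoc {x y z t : A.Ob} (f : A.Mor x y) (g : A.Mor y z) (h : A.Mor z t) :
    (⟨t, compMor f (compMor g h), compMap f (compMor g h) ≫ (𝟙 (weight f) ⊗ₘ compMap g h)⟩ :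
      WeightedMor x (weight f ⊗ weight g ⊗ weight h)) =
    ⟨t, compMor (compMor f g) h,
      compMap (compMor f g) h ≫ (compMap f g ⊗ₘ 𝟙 (weight h)) ≫ (α_ _ _ _).hom⟩ := by
  rw [← Category.assoc]
  exact WeightedMor.mk_eq_of_hom_eq (e_assoc (FormalCoproduct.{w} Cᵒᵖ) x y z t).symm (f, g, h)

end laws

/-- The outfacing polynomial `∑ x, ∏ (y, f : x → y), |f|` of an enriched category. -/
def outPoly (A : SmallEnrichedCat.{w} C) : PolyIn.{w} C where
  pos := A.Ob
  dir x := Σ y, A.Mor x y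
  pred _ f := weight f.2

/-- A weighted morphism, as a weighted direction of the outfacing polynomial. -/
def WeightedMor.toDir {A : SmallEnrichedCat.{w} C} {a : A.Ob} {c : C} (t : WeightedMor a c) :
    PolyIn.WeightedDir A.outPoly a c :=
  ⟨⟨t.cod, t.mor⟩, t.map⟩

theorem WeightedMor.toDir_injective {A : SmallEnrichedCat.{w} C} {a : A.Ob} {c : C} :
    Function.Injective (WeightedMor.toDir (A := A) (a := a) (c := c)) := by
  rintro ⟨y, f, m⟩ ⟨y', f', m'⟩ h
  cases h
  rfl

/-- Both sides of each comonoid law agree on positions by definition, so only the category law on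
weighted morphisms remains. -/
instance outPolyComonObj (A : SmallEnrichedCat.{w} C) : ComonObj A.outPoly where
  counit := PolyIn.Hom.mk (fun _ => PUnit.unit) (fun x _ => ⟨x, idMor x⟩) (fun x _ => idMap x)
  comul := PolyIn.Hom.mk (fun x => ⟨x, fun f => f.1⟩) (fun _ f => ⟨f.2.1, compMor f.1.2 f.2.2⟩)
    (fun _ f => compMap f.1.2 f.2.2)
  counit_comul := PolyIn.hom_mk_eq_iff.2 fun _ b =>
    congrArg WeightedMor.toDir (idMor_comp b.2.2)
  comul_counit := PolyIn.hom_mk_eq_iff.2 fun _ b =>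
    congrArg WeightedMor.toDir (comp_idMor b.1.2)
  comul_assoc := PolyIn.hom_mk_eq_iff.2 fun _ b =>
    congrArg WeightedMor.toDir (comp_assoc b.1.2 b.2.1.2 b.2.2.2)

/-! ### Enriched cofunctors as comonoid morphisms -/

variable {A B : SmallEnrichedCat.{w} C}

/-- The lift of a morphism of `B` along a morphism of outfacing polynomials. -/
def polyLift (f : A.outPoly ⟶ B.outPoly) {a : A.Ob} {b b' : B.Ob} (h : f.onPos a = b)
    (g : B.Mor b b') : WeightedMor a (weight g) := by
  subst h
  exact ⟨(f.onDir a ⟨b', g⟩).1, (f.onDir a ⟨b', g⟩).2, f.onPred a ⟨b', g⟩⟩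

theorem onPos_polyLift_cod {f : A.outPoly ⟶ B.outPoly}
    (hf : ∀ a x, f.onPos (f.onDir a x).1 = x.1) {a : A.Ob} {b b' : B.Ob} (h : f.onPos a = b)
    (g : B.Mor b b') : f.onPos (polyLift f h g).cod = b' := by
  subst h
  exact hf a ⟨b', g⟩

/-- Extracts the codomain function from an equation of positions without heterogeneous equality. -/
theorem fst_eq_of_sigma_eq {b : B.Ob} {j : (B.outPoly ⊗ B.outPoly).pos}
    (h : (⟨b, fun x => x.1⟩ : (B.outPoly ⊗ B.outPoly).pos) = j) (x : B.outPoly.dir j.1) :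
    x.1 = j.2 x := by
  subst h
  rfl

/-- A morphism of outfacing polynomials that preserves codomains preserves comultiplications if
and only if it preserves composites. -/
theorem comp_comul_eq_iff {f : A.outPoly ⟶ B.outPoly}
    (hf : ∀ a x, f.onPos (f.onDir a x).1 = x.1) :
    f ≫ ComonObj.comul = ComonObj.comul ≫ (f ⊗ₘ f) ↔
      ∀ (a : A.Ob) (b b' : B.Ob) (g : B.Mor (f.onPos a) b) (g' : B.Mor b b'),
        (polyLift f rfl (compMor g g')).post (compMap g g') =
          (polyLift f rfl g).comp (polyLift f (onPos_polyLift_cod hf rfl g) g') := by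
  have h : ∀ a, PolyIn.Hom.onPos (f ≫ ComonObj.comul) a =
      PolyIn.Hom.onPos (ComonObj.comul ≫ (f ⊗ₘ f)) a := fun a =>
    congrArg (fun k => (⟨f.onPos a, k⟩ : (B.outPoly ⊗ B.outPoly).pos))
      (funext fun x => (hf a x).symm)
  -- The family lifts `x.1`, then `x.2` from the codomain reached. Over the position given by `comul
  -- ≫ (f ⊗ₘ f)` it is that morphism by definition; over `rfl` it is the composite of lifts.
  rw [PolyIn.family_rfl_eq_iff h (fun a j e x =>
    ((polyLift f (congrArg Sigma.fst e) x.1.2).comp (polyLift f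
      ((onPos_polyLift_cod hf _ _).trans (fst_eq_of_sigma_eq e x.1)) x.2.2)).toDir) ?_]
  · constructor
    · exact fun H a b b' g g' =>
        (WeightedMor.toDir_injective (H a ⟨⟨b, g⟩, ⟨b', g'⟩⟩)).symm
    · exact fun H a x => congrArg WeightedMor.toDir (H a _ _ x.1.2 x.2.2).symm
  · exact fun a x => rfl

theorem comp_counit_eq_iff {f : A.outPoly ⟶ B.outPoly} :
    f ≫ ComonObj.counit = ComonObj.counit ↔
      ∀ a, (polyLift f rfl (idMor (f.onPos a))).post (idMap _) = WeightedMor.unit a := by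
  refine PolyIn.hom_mk_eq_iff.trans ⟨fun H a => ?_, fun H a _ => ?_⟩
  · exact WeightedMor.toDir_injective (H a PUnit.unit)
  · exact congrArg WeightedMor.toDir (H a)

/-- This is the position part of compatibility with comultiplication: the second components are the
two codomain functions. -/
theorem onPos_onDir_of_comp_comul_eq {f : A.outPoly ⟶ B.outPoly}
    (e : f ≫ ComonObj.comul = ComonObj.comul ≫ (f ⊗ₘ f)) (a : A.Ob)
    (x : B.outPoly.dir (f.onPos a)) : f.onPos (f.onDir a x).1 = x.1 :=
  (fst_eq_of_sigma_eq (j := ⟨f.onPos a, fun x => f.onPos (f.onDir a x).1⟩)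
    (congrFun (congrArg PolyIn.Hom.onPos e) a) x).symm

/-- The morphism of outfacing polynomials underlying an enriched cofunctor. -/
def EnrichedCofunctor.polyHom (F : EnrichedCofunctor A B) : A.outPoly ⟶ B.outPoly :=
  PolyIn.Hom.mk F.obj (fun _ x => ⟨(F.lift rfl x.2).cod, (F.lift rfl x.2).mor⟩)
    (fun _ x => (F.lift rfl x.2).map)

theorem polyLift_polyHom (F : EnrichedCofunctor A B) {a : A.Ob} {b b' : B.Ob} (h : F.obj a = b)
    (g : B.Mor b b') : polyLift F.polyHom h g = F.lift h g := by
  subst h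
  rfl

theorem EnrichedCofunctor.polyHom_injective :
    Function.Injective (EnrichedCofunctor.polyHom (A := A) (B := B)) := by
  intro F G e
  have ho : ∀ a, F.obj a = G.obj a := congrFun (congrArg PolyIn.Hom.onPos e)
  refine EnrichedCofunctor.ext' ho fun hF hG g => ?_
  -- As values of `polyLift`, the two lifts differ only in the polynomial morphism and a proof, so
  -- `e` identifies them.
  rw [← polyLift_polyHom F, ← polyLift_polyHom G]
  congr 1

instance (F : EnrichedCofunctor A B) : IsComonHom F.polyHom where
  hom_counit := comp_counit_eq_iff.2 fun _ => F.lift_id rfl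
  hom_comul := (comp_comul_eq_iff fun _ x => F.obj_cod rfl x.2).2 fun _ _ _ g g' =>
    (F.lift_comp rfl g g').trans (congrArg _ (polyLift_polyHom F _ g').symm)

/-- The enriched cofunctor given by a comonoid morphism of outfacing polynomials. -/
def cofunctorOfPolyHom (f : A.outPoly ⟶ B.outPoly) [IsComonHom f] : EnrichedCofunctor A B where
  obj := f.onPos
  lift := polyLift f
  obj_cod := onPos_polyLift_cod (onPos_onDir_of_comp_comul_eq (IsComonHom.hom_comul f))
  lift_id := by
    rintro a _ rfl
    exact comp_counit_eq_iff.1 (IsComonHom.hom_counit f) a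
  lift_comp := by
    rintro a _ b b' rfl g g'
    exact (comp_comul_eq_iff (onPos_onDir_of_comp_comul_eq (IsComonHom.hom_comul f))).1
      (IsComonHom.hom_comul f) a b b' g g'

variable (C) in
/-- The functor that sends an enriched category to its outfacing polynomial. -/
def toComon : SmallEnrichedCat.{w} C ⥤ Comon (PolyIn.{w} C) where
  obj A := ⟨A.outPoly⟩
  map {A B} F := ⟨EnrichedCofunctor.polyHom (A := A) (B := B) F⟩
  map_id _ := rfl
  map_comp _ _ := rfl

instance : (toComon.{w} C).Faithful where
  map_injective e := EnrichedCofunctor.polyHom_injective (congrArg Comon.Hom.hom e)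

instance : (toComon.{w} C).Full where
  map_surjective f :=
    have : IsComonHom (M := outPoly _) (N := outPoly _) f.hom := f.isComonHom_hom
    ⟨cofunctorOfPolyHom f.hom, rfl⟩

end SmallEnrichedCat

/-! ### Comonoids as category structures on polynomials -/

namespace PolyIn

variable {C : Type u} [Category.{v} C] [MonoidalCategory C]

/-- Two equal morphisms into a composition product that are the identity on the first components of
positions: a family which restricts to the components of the first one restricts to those of the
second one. -/
theorem family_eq_of_compProd_hom_eq {P Q : PolyIn.{w} C} {K K' : ∀ i, P.dir i → Q.pos}
    {d : ∀ i, (compProd P Q).dir ⟨i, K i⟩ → P.dir i}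
    {m : ∀ i b, P.pred i (d i b) ⟶ (compProd P Q).pred ⟨i, K i⟩ b}
    {d' : ∀ i, (compProd P Q).dir ⟨i, K' i⟩ → P.dir i}
    {m' : ∀ i b, P.pred i (d' i b) ⟶ (compProd P Q).pred ⟨i, K' i⟩ b}
    (e : (Hom.mk (fun i => ⟨i, K i⟩) d m : P ⟶ compProd P Q) =
      (Hom.mk (fun i => ⟨i, K' i⟩) d' m' : P ⟶ compProd P Q))
    (t : ∀ i k, K i = k → ∀ b : (compProd P Q).dir ⟨i, k⟩,
      WeightedDir P i ((compProd P Q).pred ⟨i, k⟩ b))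
    (ht : ∀ i b, t i _ rfl b = ⟨d i b, m i b⟩) (i : P.pos) :
    ∃ h : K i = K' i, ∀ b, t i _ h b = ⟨d' i b, m' i b⟩ := by
  have hK : K = K' := funext fun i =>
    eq_of_heq (Sigma.mk.inj (congrFun (congrArg Hom.onPos e) i)).2
  subst hK
  exact ⟨rfl, fun b => (ht i b).trans (hom_mk_eq_iff.1 e i b)⟩

/-- A category structure on a polynomial: the directions at `i` are the morphisms out of `i`. -/
structure CatStr (P : PolyIn.{w} C) where
  /-- the codomain of a direction -/
  cod (i : P.pos) : P.dir i → P.pos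
  /-- the identity directions, with their maps to the unit -/
  one (i : P.pos) : WeightedDir P i (𝟙_ C)
  /-- the composites of directions, with their maps to the tensor product -/
  mul {i : P.pos} (a : P.dir i) {j : P.pos} (h : cod i a = j) (b : P.dir j) :
    WeightedDir P i (P.pred i a ⊗ P.pred j b)
  cod_one (i : P.pos) : cod i (one i).dir = i
  cod_mul {i : P.pos} (a : P.dir i) {j : P.pos} (h : cod i a = j) (b : P.dir j) :
    cod i (mul a h b).dir = cod j b
  one_mul (i : P.pos) (b : P.dir i) :
    (mul (one i).dir (cod_one i) b).post ((one i).map ⊗ₘ 𝟙 _) = ⟨b, (λ_ _).inv⟩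
  mul_one {i : P.pos} (a : P.dir i) {j : P.pos} (h : cod i a = j) :
    (mul a h (one j).dir).post (𝟙 _ ⊗ₘ (one j).map) = ⟨a, (ρ_ _).inv⟩
  mul_assoc {i : P.pos} (a : P.dir i) {j : P.pos} (h : cod i a = j) (b : P.dir j) {k : P.pos}
    (h' : cod j b = k) (c : P.dir k) :
    (mul (mul a h b).dir ((cod_mul a h b).trans h') c).post
        (((mul a h b).map ⊗ₘ 𝟙 _) ≫ (α_ _ _ _).hom) =
      (mul a h (mul b h' c).dir).post (𝟙 _ ⊗ₘ (mul b h' c).map)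

namespace CatStr

variable {P : PolyIn.{w} C}

/-- The counit of a category structure on a polynomial. -/
def counit (S : CatStr P) : P ⟶ compUnit :=
  Hom.mk (fun _ => PUnit.unit) (fun i _ => (S.one i).dir) (fun i _ => (S.one i).map)

/-- The comultiplication of a category structure on a polynomial. -/
def comul (S : CatStr P) : P ⟶ compProd P P :=
  Hom.mk (fun i => ⟨i, S.cod i⟩) (fun _ x => (S.mul x.1 rfl x.2).dir)
    (fun _ x => (S.mul x.1 rfl x.2).map)

end CatStr

section ofComonoid

variable {P : PolyIn.{w} C} {cod : ∀ i, P.dir i → P.pos}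

/-- The components of a comultiplication, at a direction `b` of a position equal to `cod i a`. -/
def mulOf (d : ∀ i, (compProd P P).dir ⟨i, cod i⟩ → P.dir i)
    (m : ∀ i b, P.pred i (d i b) ⟶ (compProd P P).pred ⟨i, cod i⟩ b) {i : P.pos} (a : P.dir i)
    {j : P.pos} (h : cod i a = j) (b : P.dir j) : WeightedDir P i (P.pred i a ⊗ P.pred j b) := by
  subst h
  exact ⟨d i ⟨a, b⟩, m i ⟨a, b⟩⟩

/-- Because `k` is arbitrary, this both types the triple composites before `cod_mul` is known and
later yields `cod_mul`. -/
theorem cod_mulOf_eq_of_sigma_eq (d : ∀ i, (compProd P P).dir ⟨i, cod i⟩ → P.dir i)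
    (m : ∀ i b, P.pred i (d i b) ⟶ (compProd P P).pred ⟨i, cod i⟩ b) {i : P.pos} (a : P.dir i)
    {k : (compProd P P).pos}
    (h : (⟨cod i a, fun b => cod i (d i ⟨a, b⟩)⟩ : (compProd P P).pos) = k) (b : P.dir k.1) :
    cod i (mulOf d m a (congrArg Sigma.fst h) b).dir = k.2 b := by
  subst h
  rfl

/-- Every comonoid structure comes from a category structure. -/
theorem exists_catStr (e : P ⟶ compUnit) (δ : P ⟶ compProd P P)
    (counit_comul : δ ≫ compProdMap e (𝟙 P) = (compLeftUnitor P).inv)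
    (comul_counit : δ ≫ compProdMap (𝟙 P) e = (compRightUnitor P).inv)
    (comul_assoc : δ ≫ compProdMap (𝟙 P) δ =
      δ ≫ compProdMap δ (𝟙 P) ≫ (compAssociator P P P).hom) :
    ∃ S : CatStr P, e = S.counit ∧ δ = S.comul := by
  obtain ⟨p, d, m⟩ := δ
  -- On positions the right counit law fixes the first component of `p i`; the second is the
  -- codomain function.
  have hp : ∀ i, ∃ c : P.dir i → P.pos, p i = ⟨i, c⟩ := by
    intro i
    have h : (p i).1 = i := congrArg Sigma.fst (congrFun (congrArg Hom.onPos comul_counit) i)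
    revert h
    rcases p i with ⟨i', c⟩
    rintro (rfl : i' = i)
    exact ⟨c, rfl⟩
  choose cod hcod using hp
  obtain rfl : p = fun i => ⟨i, cod i⟩ := funext hcod
  clear hcod
  have cod_one : ∀ i, cod i (e.onDir i PUnit.unit) = i := fun i =>
    congrArg (fun x : (compProd compUnit P).pos => x.2 PUnit.unit)
      (congrFun (congrArg Hom.onPos counit_comul) i)
  -- The family consists of the left-nested triple composites. The position half of the conclusion
  -- gives `cod_mul`, the direction half associativity.
  have hassoc := family_eq_of_compProd_hom_eq (Q := compProd P P) comul_assoc.symm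
    (fun i k h x => (mulOf d m (mulOf d m x.1 (congrArg Sigma.fst (congrFun h x.1)) x.2.1).dir
      (cod_mulOf_eq_of_sigma_eq d m x.1 (congrFun h x.1) x.2.1) x.2.2).post
        (((mulOf d m x.1 (congrArg Sigma.fst (congrFun h x.1)) x.2.1).map ⊗ₘ 𝟙 _) ≫
          (α_ _ _ _).hom)) (fun _ _ => rfl)
  have cod_mul : ∀ {i : P.pos} (a : P.dir i) {j : P.pos} (h : cod i a = j) (b : P.dir j),
      cod i (mulOf d m a h b).dir = cod j b := by
    rintro i a _ rfl b
    exact cod_mulOf_eq_of_sigma_eq d m a (congrFun (hassoc i).1 a) b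
  refine ⟨⟨cod, fun i => ⟨e.onDir i PUnit.unit, e.onPred i PUnit.unit⟩, mulOf d m, cod_one, cod_mul,
    fun i b => ?_, ?_, ?_⟩, rfl, ?_⟩
  -- The left law compares directions at `cod i (one i).dir` with directions at `i`, so it needs a
  -- family; in the right law the positions agree by definition.
  · exact family_eq_of_hom_eq counit_comul (fun i k h x =>
      (mulOf d m (e.onDir i PUnit.unit)
        (congrArg (fun x : (compProd compUnit P).pos => x.2 PUnit.unit) h) x.2).post
        (e.onPred i PUnit.unit ⊗ₘ 𝟙 _)) (fun _ _ => rfl) i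
      (congrFun (congrArg Hom.onPos counit_comul) i) ⟨PUnit.unit, b⟩
  · rintro i a _ rfl
    exact hom_mk_eq_iff.1 comul_counit i ⟨a, PUnit.unit⟩
  · rintro i a _ rfl b _ rfl c
    exact (hassoc i).2 ⟨a, b, c⟩
  · rfl

end ofComonoid

/-! ### From category structures to enriched categories -/

namespace CatStr

variable {P : PolyIn.{w} C} (S : CatStr P)

/-- The hom-object `∑ (a : i → j), |a|` of a category structure on a polynomial. -/
def homObj (i j : P.pos) : FormalCoproduct.{w} Cᵒᵖ :=
  ⟨{a : P.dir i // S.cod i a = j}, fun a => Opposite.op (P.pred i a.1)⟩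

variable {S} in
-- The codomain condition is a proposition, so an index is determined by its direction and the
-- enriched laws can be checked on weighted directions.
theorem homObj_hom_ext {i j : P.pos} {X : FormalCoproduct.{w} Cᵒᵖ} {k k' : X ⟶ S.homObj i j}
    (h : ∀ x, (⟨(k.f x).1, (k.φ x).unop⟩ : WeightedDir P i (X.obj x).unop) =
      ⟨(k'.f x).1, (k'.φ x).unop⟩) : k = k' := by
  obtain ⟨f, φ⟩ := k
  obtain ⟨f', φ'⟩ := k'
  obtain rfl : f = f' := funext fun x => Subtype.ext (congrArg WeightedDir.dir (h x))
  exact DayFormalCoproduct.hom_mk_congr fun x =>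
    Quiver.Hom.unop_inj (eq_of_heq (WeightedDir.mk.inj (h x)).2)

theorem one_mul_post (i : P.pos) (b : P.dir i) :
    (S.mul (S.one i).dir (S.cod_one i) b).post (((S.one i).map ⊗ₘ 𝟙 _) ≫ (λ_ _).hom) =
      ⟨b, 𝟙 _⟩ := by
  simpa [WeightedDir.post] using congrArg (fun t => t.post (λ_ _).hom) (S.one_mul i b)

theorem mul_one_post {i : P.pos} (a : P.dir i) {j : P.pos} (h : S.cod i a = j) :
    (S.mul a h (S.one j).dir).post ((𝟙 _ ⊗ₘ (S.one j).map) ≫ (ρ_ _).hom) = ⟨a, 𝟙 _⟩ := by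
  simpa [WeightedDir.post] using congrArg (fun t => t.post (ρ_ _).hom) (S.mul_one a h)

/-- The enriched category given by a category structure on a polynomial. -/
def toEnrichedCat : SmallEnrichedCat.{w} C where
  Ob := P.pos
  enriched :=
    { Hom := S.homObj
      id i := FormalCoproduct.Hom.mk (fun _ => ⟨(S.one i).dir, S.cod_one i⟩)
        (fun _ => (S.one i).map.op)
      comp i j k := FormalCoproduct.Hom.mk
        (fun x => ⟨(S.mul x.1.1 x.1.2 x.2.1).dir, (S.cod_mul _ _ _).trans x.2.2⟩)
        (fun x => (S.mul x.1.1 x.1.2 x.2.1).map.op)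
      id_comp i j := homObj_hom_ext fun x => by
        have := S.one_mul_post i x.1
        rw [WeightedDir.post, ← Category.assoc] at this
        exact this
      comp_id i j := homObj_hom_ext fun x => by
        have := S.mul_one_post x.1 x.2
        rw [WeightedDir.post, ← Category.assoc] at this
        exact this
      assoc i j k l := homObj_hom_ext fun x => by
        have := S.mul_assoc x.1.1 x.1.2 x.2.1.1 x.2.1.2 x.2.2.1
        rw [WeightedDir.post, ← Category.assoc] at this
        exact this }

/-- The outfacing polynomial of the enriched category given by a category structure on `P` is
isomorphic to `P`. -/
def outPolyIso : S.toEnrichedCat.outPoly ≅ P where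
  hom := Hom.mk (fun i => i) (fun i a => ⟨S.cod i a, ⟨a, rfl⟩⟩) (fun i a => 𝟙 (P.pred i a))
  inv := Hom.mk (fun i => i) (fun i x => x.2.1) (fun i x => 𝟙 (P.pred i x.2.1))
  hom_inv_id := hom_mk_eq_iff.2 (by
    rintro i ⟨_, a, rfl⟩
    exact congrArg (WeightedDir.mk _) (Category.id_comp _))
  inv_hom_id := hom_mk_congr fun _ _ => Category.id_comp _

/-- Replaces the canonical codomain chosen by `outPolyIso` with the one recorded by the identities
and composites of the enriched category. -/
theorem outPoly_mk_eq {i j : P.pos} (a : P.dir i) (h : S.cod i a = j) {c : C}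
    (m : P.pred i a ⟶ c) :
    (⟨⟨S.cod i a, ⟨a, rfl⟩⟩, m⟩ : WeightedDir S.toEnrichedCat.outPoly i c) =
      ⟨⟨j, ⟨a, h⟩⟩, m⟩ := by
  subst h
  rfl

theorem outPolyIso_hom_counit :
    S.outPolyIso.hom ≫ S.counit = ComonObj.counit (X := S.toEnrichedCat.outPoly) :=
  hom_mk_eq_iff.2 fun i _ =>
    (congrArg (WeightedDir.mk _) (Category.id_comp _)).trans
      (S.outPoly_mk_eq (S.one i).dir (S.cod_one i) (S.one i).map)

theorem outPolyIso_hom_comul :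
    S.outPolyIso.hom ≫ S.comul = ComonObj.comul (X := S.toEnrichedCat.outPoly) ≫
      (S.outPolyIso.hom ⊗ₘ S.outPolyIso.hom) :=
  hom_mk_eq_iff.2 fun i x => by
    have h := S.outPoly_mk_eq (S.mul x.1 rfl x.2).dir (S.cod_mul x.1 rfl x.2)
      (S.mul x.1 rfl x.2).map
    refine (congrArg (WeightedDir.mk _) (Category.id_comp _)).trans (h.trans ?_)
    refine congrArg (WeightedDir.mk _) ?_
    -- The predicate maps of `outPolyIso` are identities, hence so is their tensor product.
    exact ((congrArg (_ ≫ ·) (id_tensorHom_id _ _)).trans (Category.comp_id _)).symm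

end CatStr

end PolyIn

/-! ### Essential surjectivity and the equivalence -/

namespace SmallEnrichedCat

variable {C : Type u} [Category.{v} C] [MonoidalCategory C]

instance : (toComon.{w} C).EssSurj where
  mem_essImage M := by
    obtain ⟨S, he, hd⟩ := PolyIn.exists_catStr (P := M.X) ComonObj.counit ComonObj.comul
      (ComonObj.counit_comul M.X) (ComonObj.comul_counit M.X) (ComonObj.comul_assoc M.X)
    refine ⟨S.toEnrichedCat,
      ⟨Comon.mkIso (M := (toComon C).obj S.toEnrichedCat) S.outPolyIso ?_ ?_⟩⟩
    · rw [he]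
      exact S.outPolyIso_hom_counit
    · rw [hd]
      exact S.outPolyIso_hom_comul

end SmallEnrichedCat

theorem mainTheorem1 (C : Type u) [Category.{v} C] [MonoidalCategory C] :
    Nonempty (Comon (PolyIn.{w} C) ≌ SmallEnrichedCat.{w} C) := by
  have : (SmallEnrichedCat.toComon.{w} C).IsEquivalence := {}
  exact ⟨(SmallEnrichedCat.toComon.{w} C).asEquivalence.symm⟩
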